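/- Let $k$ be an algebraically closed field, let $0\le d\le n$ and $D\ge 1$ be integers, and let $\epsilon_0,\dots,\epsilon_d$ be the canonical basis of $\mathbb{N}^{d+1}$. Let $\mathcal{B}=\{\mathbf{b}_0,\dots,\mathbf{b}_n\}\subset\mathbb{N}^{d+1}$ be a set of $n+1$ distinct vectors $\mathbf{b}_l=(b_{l0},\dots,b_{ld})$ such that $\mathbf{b}_i=D\epsilon_i$ for $0\le i\le d$ and $b_{l0}+\dots+b_{ld}=D$ for $0\le l\le n$. Let $I_{\mathcal{B}}$ be the kernel of the $k$-algebra homomorphism $k[x_0,\dots,x_n]\to k[t_0,\dots,t_d]$, $x_l\mapsto t_0^{b_{l0}}\cdots t_d^{b_{ld}}$, and let $\mathcal{X}=V(I_{\mathcal{B}})\subset\mathbb{P}^n_k$ be the simplicial projective toric variety determined by $\mathcal{B}$. A point of $\mathcal{X}$ is singular if the local ring of $\mathcal{X}$ at that point is not regular. Let $P_i=(0:\dots:0:1:0:\dots:0)\in\mathbb{P}^n_k$, with the $1$ in position $i$, where positions are numbered from $0$. (1) If $\mathcal{X}$ has exactly one singular point, then that point is $P_i$ for some $i\in\{0,\dots,d\}$.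 (2) Assume that $\gcd\{b_{li} : 0\le l\le n,\ 0\le i\le d\}=1$. Then $P_0$ is the only singular point of $\mathcal{X}$ if and only if there is an integer $e\ge 1$ that divides $D$ and divides $b_{l0}$ for all $l\in\{0,\dots,n\}$, such that \[\{(D-1)\epsilon_i+\epsilon_j : 1\le i,j\le d\}\cup\{e\epsilon_0+(D-e)\epsilon_j : 1\le j\le d\}\subset\mathcal{B},\] and such that, if $e=1$, there is $j\in\{1,\dots,d\}$ with $(D-1)\epsilon_0+\epsilon_j\notin\mathcal{B}$. If $d\ge 2$, the "if" direction holds also without the assumption on the gcd. -/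

import Mathlib

namespace ToricSing

open MvPolynomial

noncomputable section

attribute [local instance] MvPolynomial.gradedAlgebra

/-- The toric ideal `I_B ⊆ k[x_0, …, x_n]` of the vectors `b_0, …, b_n ∈ ℕ^{d+1}`: the kernel of
`k[x_0, …, x_n] → k[t_0, …, t_d]`, `x_j ↦ t^{b_j}`. -/
def toricIdeal (k : Type*) [Field k] {n d : ℕ} (b : Fin (n + 1) → Fin (d + 1) → ℕ) :
    Ideal (MvPolynomial (Fin (n + 1)) k) :=
  RingHom.ker (aeval (fun j => ∏ l, (X l : MvPolynomial (Fin (d + 1)) k) ^ b j l) :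
    MvPolynomial (Fin (n + 1)) k →ₐ[k] MvPolynomial (Fin (d + 1)) k)

/-- The zero set `V(I) ⊆ ℙⁿ(k)` of a homogeneous ideal `I` (for such an ideal over an infinite field
the condition does not depend on the representative of `P`). -/
def zeroLocus {k : Type*} [Field k] {n : ℕ} (I : Ideal (MvPolynomial (Fin (n + 1)) k)) :
    Set (Projectivization k (Fin (n + 1) → k)) :=
  {P | ∀ f ∈ I, eval P.rep f = 0}

/-- The homogeneous prime ideal of a point `P = (p_0 : ⋯ : p_n)` of `ℙⁿ(k)`: the polynomials `f` with
`f (p_0 T, …, p_n T) = 0` in `k[T]`; it is generated by the forms vanishing at `P`. -/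
def pointIdeal {k : Type*} [Field k] {n : ℕ} (P : Projectivization k (Fin (n + 1) → k)) :
    Ideal (MvPolynomial (Fin (n + 1)) k) :=
  RingHom.ker (aeval (fun j => Polynomial.C (P.rep j) * Polynomial.X) :
    MvPolynomial (Fin (n + 1)) k →ₐ[k] Polynomial k)

instance pointIdeal_isPrime {k : Type*} [Field k] {n : ℕ}
    (P : Projectivization k (Fin (n + 1) → k)) : (pointIdeal P).IsPrime :=
  RingHom.ker_isPrime _

/-- The local ring of `ℙⁿ` at `P`: fractions `f / g` of forms of the same degree, `g(P) ≠ 0`. -/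
abbrev ProjLocalRing {k : Type*} [Field k] {n : ℕ} (P : Projectivization k (Fin (n + 1) → k)) :
    Type _ :=
  HomogeneousLocalization.AtPrime (homogeneousSubmodule (Fin (n + 1)) k) (pointIdeal P)

/-- The ideal of the closed subscheme defined by the homogeneous ideal `I` in the local ring of `ℙⁿ`
at `P`: the degree zero part of the extension of `I` to the localization at the prime of `P`. -/
def localIdeal {k : Type*} [Field k] {n : ℕ} (I : Ideal (MvPolynomial (Fin (n + 1)) k))
    (P : Projectivization k (Fin (n + 1) → k)) : Ideal (ProjLocalRing P) :=
  (I.map (algebraMap (MvPolynomial (Fin (n + 1)) k)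
    (Localization.AtPrime (pointIdeal P)))).comap
    (algebraMap (ProjLocalRing P) (Localization.AtPrime (pointIdeal P)))

/-- The local ring at `P` of the projective variety with homogeneous ideal `I`. -/
abbrev VarietyLocalRing {k : Type*} [Field k] {n : ℕ} (I : Ideal (MvPolynomial (Fin (n + 1)) k))
    (P : Projectivization k (Fin (n + 1) → k)) : Type _ :=
  ProjLocalRing P ⧸ localIdeal I P

/-- The set of singular points of the projective toric variety `X_B = V(I_B) ⊆ ℙⁿ(k)`: the points
of `X_B` at which the local ring of `X_B` is not regular. -/
def singularPoints (k : Type*) [Field k] {n d : ℕ} (b : Fin (n + 1) → Fin (d + 1) → ℕ) :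
    Set (Projectivization k (Fin (n + 1) → k)) :=
  {P | P ∈ zeroLocus (toricIdeal k b) ∧
    ¬ IsRegularLocalRing (VarietyLocalRing (toricIdeal k b) P)}

/-- The coordinate point `P_i = (0 : ⋯ : 0 : 1 : 0 : ⋯ : 0)` of `ℙⁿ(k)`. -/
def coordPoint (k : Type*) [Field k] {n : ℕ} (i : Fin (n + 1)) :
    Projectivization k (Fin (n + 1) → k) :=
  Projectivization.mk k (Pi.single i 1) (by simp)

/-- There is a divisor `e > 0` of `D`, dividing all `b_{i0}`, such that `B` contains all
`(D-1)ε_i + ε_j` and all `e ε_0 + (D-e) ε_j` for `i, j ∈ {1, …, d}` and, if `e = 1`, such that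
`(D-1)ε_0 + ε_j ∉ B` for some `j ∈ {1, …, d}`. -/
def OneSingularShape {n d : ℕ} (D : ℕ) (b : Fin (n + 1) → Fin (d + 1) → ℕ) : Prop :=
  ∃ e : ℕ, 0 < e ∧ e ∣ D ∧ (∀ l, e ∣ b l 0) ∧
    (∀ i j : Fin (d + 1), i ≠ 0 → j ≠ 0 →
      Pi.single i (D - 1) + Pi.single j 1 ∈ Set.range b) ∧
    (∀ j : Fin (d + 1), j ≠ 0 → Pi.single 0 e + Pi.single j (D - e) ∈ Set.range b) ∧
    (e = 1 → ∃ j : Fin (d + 1), j ≠ 0 ∧ Pi.single 0 (D - 1) + Pi.single j 1 ∉ Set.range b)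

end

end ToricSing

/-!
Every point of the toric variety lies in the affine chart of one of the vertices `D ε_j`. This chart
is the spectrum of the semigroup ring of the semigroup `S_j` generated by the vectors of `B` with
the `j`-th coordinate dropped, and `P_j` is its origin. The embedding dimension at the origin is at
least the number of irreducible elements of `S_j`, while the dimension is at most `d`. As `S_j`
contains a multiple of each of the `d` basis vectors, it has an irreducible element on each axis;
hence `P_j` is regular if and only if `S_j` is freely generated by multiples of the basis vectors,
and then the chart is an affine space and all its points are regular. So every chart through a
singular point has a singular vertex, and the number of singular points is governed by the vertices.

If `S_j` is free, its generators are the gcds `g_i` of the `i`-th coordinates of `B`, for `i ≠ j`,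
and `B` contains `g_i ε_i + (D - g_i) ε_j`, so that `g_j` divides every `g_i`. When the vectors of
`B` have no common divisor, this makes `g_j = 1` for every regular vertex `P_j`.
-/

namespace ToricSing

open MvPolynomial

noncomputable section

attribute [local instance] MvPolynomial.gradedAlgebra

section HomogeneousLocalization

open DirectSum HomogeneousLocalization

variable {ι σ A S : Type*} [AddCancelCommMonoid ι] [DecidableEq ι] [CommRing A] [CommRing S]
  [SetLike σ A] [AddSubgroupClass σ A] {𝒜 : ι → σ} [GradedRing 𝒜] {p : Ideal A} [p.IsPrime]

lemma exists_decompose_notMem {J : Ideal A} {u : A} (hu : u ∉ J) :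
    ∃ i, (decompose 𝒜 u i : A) ∉ J := by
  classical
  contrapose! hu
  rw [← sum_support_decompose 𝒜 u]
  exact sum_mem fun i _ => hu i

lemma exists_homogeneous_mul_mem {I J : Ideal A} (hI : I.IsHomogeneous 𝒜) {u f : A} (hu : u ∉ J)
    {N : ι} (hf : f ∈ 𝒜 N) (huf : u * f ∈ I) :
    ∃ i, ∃ v ∈ 𝒜 i, v ∉ J ∧ v * f ∈ I := by
  obtain ⟨i, hi⟩ := exists_decompose_notMem (𝒜 := 𝒜) hu
  refine ⟨i, decompose 𝒜 u i, SetLike.coe_mem _, hi, ?_⟩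
  rw [← coe_decompose_mul_add_of_right_mem 𝒜 hf]
  exact hI (i + N) huf

lemma map_eq_map_of_mk_eq_mk {φ : A →+* S} (hφ : ∀ i, ∀ a ∈ 𝒜 i, a ∉ p → IsUnit (φ a))
    {c c' : NumDenSameDeg 𝒜 p.primeCompl} (h : mk c = mk c') :
    φ c.num * φ c'.den = φ c'.num * φ c.den := by
  have hval := congrArg HomogeneousLocalization.val h
  rw [val_mk, val_mk, Localization.mk_eq_mk_iff, Localization.r_iff_exists] at hval
  obtain ⟨⟨u, hu⟩, huc⟩ := hval
  have hdiff : (c'.den * c.num - c.den * c'.num : A) ∈ 𝒜 (c.deg + c'.deg) :=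
    sub_mem (add_comm c.deg c'.deg ▸ SetLike.mul_mem_graded c'.den.2 c.num.2)
      (SetLike.mul_mem_graded c.den.2 c'.num.2)
  obtain ⟨i, v, hvi, hv, hv0⟩ := exists_homogeneous_mul_mem
    (Ideal.IsHomogeneous.bot 𝒜) hu hdiff (by simpa [mul_sub, sub_eq_zero] using huc)
  have := congrArg φ ((Submodule.mem_bot A).1 hv0)
  rw [map_mul, map_zero, (hφ i v hvi hv).mul_right_eq_zero, map_sub, sub_eq_zero, map_mul,
    map_mul] at this
  rw [mul_comm, this, mul_comm]

/-- The ring homomorphism `f / g ↦ φ f / φ g` from the degree zero part of the localization at `p`,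
for a ring homomorphism `φ` that sends the homogeneous elements outside `p` to units. -/
def homogeneousLift (φ : A →+* S) (hφ : ∀ i, ∀ a ∈ 𝒜 i, a ∉ p → IsUnit (φ a)) :
    AtPrime 𝒜 p →+* S where
  toFun z := Quotient.liftOn' z (fun c => φ c.num /ₚ (hφ _ _ c.den.2 c.den_mem).unit)
    fun _ _ h => divp_eq_divp_iff.2 (map_eq_map_of_mk_eq_mk hφ (Quotient.sound' h))
  map_one' := by
    rw [one_eq, Quotient.liftOn'_mk'', divp_eq_iff_mul_eq]; simp
  map_zero' := by
    rw [zero_eq, Quotient.liftOn'_mk'', divp_eq_iff_mul_eq]; simp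
  map_mul' := by
    rintro ⟨c⟩ ⟨c'⟩
    change φ (c * c').num /ₚ _ = (φ c.num /ₚ _) * (φ c'.num /ₚ _)
    rw [divp_mul_divp, divp_eq_divp_iff]
    simp
  map_add' := by
    rintro ⟨c⟩ ⟨c'⟩
    change φ (c + c').num /ₚ _ = (φ c.num /ₚ _) + (φ c'.num /ₚ _)
    rw [Units.divp_add_divp, divp_eq_divp_iff]
    simp [add_comm, mul_comm]

lemma homogeneousLift_mk_mul (φ : A →+* S) (hφ : ∀ i, ∀ a ∈ 𝒜 i, a ∉ p → IsUnit (φ a))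
    (c : NumDenSameDeg 𝒜 p.primeCompl) :
    homogeneousLift φ hφ (mk c) * φ c.den = φ c.num :=
  divp_eq_iff_mul_eq.1 rfl

end HomogeneousLocalization

section Dehomogenization

open DirectSum HomogeneousLocalization

variable {σ A B : Type*} [CommRing A] [CommRing B] [SetLike σ A] {𝒜 : ℕ → σ}

lemma isUnit_algebraMap_map {p : Ideal A} {q : Ideal B} [q.IsPrime] {δ : A →+* B}
    (hq : ∀ N, ∀ f ∈ 𝒜 N, (δ f ∈ q ↔ f ∈ p)) (N : ℕ) (f : A) (hf : f ∈ 𝒜 N) (hfp : f ∉ p) :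
    IsUnit ((algebraMap B (Localization.AtPrime q)).comp δ f) :=
  IsLocalization.map_units (Localization.AtPrime q) (⟨δ f, (hq N f hf).not.2 hfp⟩ : q.primeCompl)

variable [AddSubgroupClass σ A] [GradedRing 𝒜]

/-- `B` is, via `δ`, the coordinate ring of the affine chart `s ≠ 0` of the closed subscheme of
`Proj A` defined by the homogeneous ideal `I`: `δ` sets the form `s` of degree one equal to `1`, and
the forms in its kernel are those of `I`. -/
structure IsDehomogenization (𝒜 : ℕ → σ) [GradedRing 𝒜] (I : Ideal A) (s : A) (δ : A →+* B) :
    Prop where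
  surjective : Function.Surjective δ
  mem_one : s ∈ 𝒜 1
  map_eq_one : δ s = 1
  map_eq_zero_iff : ∀ {N : ℕ} {f : A}, f ∈ 𝒜 N → (δ f = 0 ↔ f ∈ I)

namespace IsDehomogenization

variable {I p : Ideal A} {s : A} {δ : A →+* B}

lemma pow_mem (h : IsDehomogenization 𝒜 I s δ) (N : ℕ) : s ^ N ∈ 𝒜 N := by
  simpa using SetLike.pow_mem_graded N h.mem_one

lemma pow_mul_mem (h : IsDehomogenization 𝒜 I s δ) (M : ℕ) {N : ℕ} {f : A} (hf : f ∈ 𝒜 N) :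
    s ^ M * f ∈ 𝒜 (M + N) :=
  SetLike.mul_mem_graded (h.pow_mem M) hf

lemma map_pow_mul (h : IsDehomogenization 𝒜 I s δ) (M : ℕ) (f : A) : δ (s ^ M * f) = δ f := by
  rw [map_mul, map_pow, h.map_eq_one, one_pow, one_mul]

lemma exists_homogenization (h : IsDehomogenization 𝒜 I s δ) (g : A) :
    ∃ N, ∃ G ∈ 𝒜 N, δ G = δ g ∧ ∀ J : Ideal A, J.IsHomogeneous 𝒜 → g ∈ J → G ∈ J := by
  classical
  let N := (decompose 𝒜 g).support.sup id
  refine ⟨N, ∑ i ∈ (decompose 𝒜 g).support, s ^ (N - i) * decompose 𝒜 g i,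
    sum_mem fun i hi => ?_, ?_, fun J hJ hg => sum_mem fun i _ => J.mul_mem_left _ (hJ i hg)⟩
  · have hiN : i ≤ N := Finset.le_sup (f := id) hi
    simpa [Nat.sub_add_cancel hiN] using h.pow_mul_mem (N - i) (decompose 𝒜 g i).2
  · conv_rhs => rw [← sum_support_decompose 𝒜 g]
    simp only [map_sum, h.map_pow_mul]

lemma exists_homogeneous_map_eq (h : IsDehomogenization 𝒜 I s δ) (a : B) :
    ∃ N, ∃ G ∈ 𝒜 N, δ G = a := by
  obtain ⟨g, rfl⟩ := h.surjective a
  obtain ⟨N, G, hG, hGg, -⟩ := h.exists_homogenization g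
  exact ⟨N, G, hG, hGg⟩

lemma map_eq_map_iff (h : IsDehomogenization 𝒜 I s δ) {M N : ℕ} {f g : A} (hf : f ∈ 𝒜 M)
    (hg : g ∈ 𝒜 N) : δ f = δ g ↔ s ^ N * f - s ^ M * g ∈ I := by
  rw [← h.map_eq_zero_iff
      (sub_mem (h.pow_mul_mem N hf) (add_comm M N ▸ h.pow_mul_mem M hg)),
    map_sub, h.map_pow_mul, h.map_pow_mul, sub_eq_zero]

lemma map_mem_map_iff [p.IsPrime] (h : IsDehomogenization 𝒜 I s δ) (hp : p.IsHomogeneous 𝒜)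
    (hIp : I ≤ p) (hs : s ∉ p) {N : ℕ} {f : A} (hf : f ∈ 𝒜 N) : δ f ∈ p.map δ ↔ f ∈ p := by
  refine ⟨fun hfp => ?_, Ideal.mem_map_of_mem δ⟩
  obtain ⟨g, hg, hgf⟩ := (Ideal.mem_map_iff_of_surjective δ h.surjective).1 hfp
  obtain ⟨M, G, hG, hGg, hGp⟩ := h.exists_homogenization g
  have hdiff := hIp ((h.map_eq_map_iff hf hG).1 (hgf.symm.trans hGg.symm))
  exact (‹p.IsPrime›.mem_or_mem
    ((p.sub_mem_iff_left (p.mul_mem_left _ (hGp p hp hg))).1 hdiff)).resolve_left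
      fun hsM => hs (‹p.IsPrime›.mem_of_pow_mem M hsM)

lemma isPrime_map [p.IsPrime] (h : IsDehomogenization 𝒜 I s δ) (hp : p.IsHomogeneous 𝒜)
    (hIp : I ≤ p) (hs : s ∉ p) : (p.map δ).IsPrime where
  ne_top' := by
    rw [Ne, Ideal.eq_top_iff_one, ← map_one δ,
      h.map_mem_map_iff hp hIp hs (SetLike.one_mem_graded 𝒜)]
    exact Ideal.one_notMem p
  mem_or_mem' {x y} hxy := by
    obtain ⟨M, F, hF, rfl⟩ := h.exists_homogeneous_map_eq x
    obtain ⟨N, G, hG, rfl⟩ := h.exists_homogeneous_map_eq y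
    rw [← map_mul, h.map_mem_map_iff hp hIp hs (SetLike.mul_mem_graded hF hG)] at hxy
    exact (‹p.IsPrime›.mem_or_mem hxy).imp (Ideal.mem_map_of_mem δ) (Ideal.mem_map_of_mem δ)

section LocalRing

variable [p.IsPrime] {q : Ideal B} [q.IsPrime]

lemma homogeneousLift_surjective (h : IsDehomogenization 𝒜 I s δ)
    (hq : ∀ N, ∀ f ∈ 𝒜 N, (δ f ∈ q ↔ f ∈ p)) :
    Function.Surjective (homogeneousLift _ (isUnit_algebraMap_map hq)) := by
  intro z
  obtain ⟨x, ⟨y, hy⟩, rfl⟩ := IsLocalization.exists_mk'_eq q.primeCompl z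
  obtain ⟨M, F, hF, rfl⟩ := h.exists_homogeneous_map_eq x
  obtain ⟨N, G, hG, rfl⟩ := h.exists_homogeneous_map_eq y
  have hden : s ^ M * G ∈ 𝒜 (N + M) := add_comm M N ▸ h.pow_mul_mem M hG
  let c : NumDenSameDeg 𝒜 p.primeCompl :=
    ⟨N + M, ⟨s ^ N * F, h.pow_mul_mem N hF⟩, ⟨s ^ M * G, hden⟩,
      (hq _ _ hden).not.1 (by rwa [h.map_pow_mul])⟩
  refine ⟨HomogeneousLocalization.mk c, IsLocalization.eq_mk'_iff_mul_eq.2 ?_⟩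
  simpa only [c, RingHom.comp_apply, h.map_pow_mul] using
    homogeneousLift_mk_mul _ (isUnit_algebraMap_map hq) c

lemma ker_homogeneousLift (h : IsDehomogenization 𝒜 I s δ) (hI : I.IsHomogeneous 𝒜)
    (hq : ∀ N, ∀ f ∈ 𝒜 N, (δ f ∈ q ↔ f ∈ p)) :
    RingHom.ker (homogeneousLift _ (isUnit_algebraMap_map hq)) =
      (I.map (algebraMap A (Localization.AtPrime p))).comap
        (algebraMap (AtPrime 𝒜 p) (Localization.AtPrime p)) := by
  ext z
  obtain ⟨c, rfl⟩ := mk_surjective z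
  have hden := isUnit_algebraMap_map hq _ _ c.den.2 c.den_mem
  rw [RingHom.mem_ker, ← hden.mul_left_eq_zero, homogeneousLift_mk_mul, RingHom.comp_apply,
    IsLocalization.map_eq_zero_iff q.primeCompl, Ideal.mem_comap,
    HomogeneousLocalization.algebraMap_apply, val_mk, Localization.mk_eq_mk',
    IsLocalization.mk'_mem_map_algebraMap_iff]
  constructor
  · rintro ⟨⟨w, hw⟩, hw0⟩
    obtain ⟨N, G, hG, rfl⟩ := h.exists_homogeneous_map_eq w
    refine ⟨G, (hq _ _ hG).not.1 hw, (h.map_eq_zero_iff (SetLike.mul_mem_graded hG c.num.2)).1 ?_⟩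
    rwa [map_mul]
  · rintro ⟨u, hu, hu0⟩
    obtain ⟨N, v, hvN, hv, hv0⟩ := exists_homogeneous_mul_mem hI hu c.num.2 hu0
    refine ⟨⟨δ v, (hq _ _ hvN).not.2 hv⟩, ?_⟩
    rw [← map_mul, h.map_eq_zero_iff (SetLike.mul_mem_graded hvN c.num.2)]
    exact hv0

/-- The local ring of a closed subscheme of `Proj A` at a point is the local ring of an affine chart
at the corresponding prime. -/
def localRingEquiv (h : IsDehomogenization 𝒜 I s δ) (hI : I.IsHomogeneous 𝒜)
    (hq : ∀ N, ∀ f ∈ 𝒜 N, (δ f ∈ q ↔ f ∈ p)) :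
    (AtPrime 𝒜 p ⧸ (I.map (algebraMap A (Localization.AtPrime p))).comap
      (algebraMap (AtPrime 𝒜 p) (Localization.AtPrime p))) ≃+* Localization.AtPrime q :=
  (Ideal.quotEquivOfEq (h.ker_homogeneousLift hI hq).symm).trans
    (RingHom.quotientKerEquivOfSurjective (h.homogeneousLift_surjective hq))

end LocalRing

end IsDehomogenization

end Dehomogenization

section MonomialMap

variable {R ι κ κ' : Type*} [CommSemiring R]

/-- The homomorphism of polynomial rings `x_l ↦ t^{a_l}`. -/
def monomialMap (R : Type*) [CommSemiring R] (a : ι → κ →₀ ℕ) :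
    MvPolynomial ι R →ₐ[R] MvPolynomial κ R :=
  aeval fun l => monomial (a l) 1

lemma monomialMap_X (a : ι → κ →₀ ℕ) (l : ι) :
    monomialMap R a (X l) = monomial (a l) 1 :=
  aeval_X _ l

lemma monomialMap_monomial (a : ι → κ →₀ ℕ) (u : ι →₀ ℕ) (r : R) :
    monomialMap R a (monomial u r) = monomial (Finsupp.linearCombination ℕ a u) r := by
  rw [monomialMap, aeval_monomial, Finsupp.linearCombination_apply, Finsupp.prod, Finsupp.sum,
    algebraMap_eq]
  simp only [monomial_pow, one_pow]
  rw [← monomial_sum_one, C_mul_monomial, mul_one]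

lemma monomialMap_surjective {a : ι → κ →₀ ℕ} (h : ∀ i, ∃ l, a l = Finsupp.single i 1) :
    Function.Surjective (monomialMap R a) := by
  rw [← AlgHom.range_eq_top, ← top_le_iff, ← MvPolynomial.adjoin_range_X, Algebra.adjoin_le_iff]
  rintro _ ⟨i, rfl⟩
  obtain ⟨l, hl⟩ := h i
  exact ⟨X l, by rw [AlgHom.toRingHom_eq_coe, RingHom.coe_coe, monomialMap_X, hl]; rfl⟩

lemma monomialMap_X_pow [Fintype κ] {a : ι → κ →₀ ℕ} {v : κ → ι} {D : ℕ}
    (hv : ∀ i, a (v i) = Finsupp.single i D) (l : ι) :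
    monomialMap R a (X l) ^ D = ∏ i, monomialMap R a (X (v i)) ^ a l i := by
  have hsum : D • a l = ∑ i, a l i • Finsupp.single i D := by
    rw [← Finsupp.univ_sum_single (D • a l)]
    exact Finset.sum_congr rfl fun i _ => by
      rw [Finsupp.smul_single, Finsupp.smul_apply, smul_eq_mul, smul_eq_mul, mul_comm]
  simp only [monomialMap_X, monomial_pow, one_pow, hv]
  rw [← monomial_sum_one, hsum]

lemma coeff_monomialMap [DecidableEq κ] (a : ι → κ →₀ ℕ) (f : MvPolynomial ι R) (w : κ →₀ ℕ) :
    coeff w (monomialMap R a f) =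
      ∑ u ∈ f.support with Finsupp.linearCombination ℕ a u = w, coeff u f := by
  conv_lhs => rw [f.as_sum, map_sum, coeff_sum]
  simp only [monomialMap_monomial, coeff_monomial, Finset.sum_filter]

lemma monomialMap_eq_zero_of_linearCombination_eq_imp {a : ι → κ →₀ ℕ} {a' : ι → κ' →₀ ℕ}
    {f : MvPolynomial ι R}
    (h : ∀ u ∈ f.support, ∀ v ∈ f.support,
      Finsupp.linearCombination ℕ a u = Finsupp.linearCombination ℕ a v ↔
      Finsupp.linearCombination ℕ a' u = Finsupp.linearCombination ℕ a' v)
    (hf : monomialMap R a f = 0) : monomialMap R a' f = 0 := by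
  classical
  ext w
  rw [coeff_monomialMap, coeff_zero]
  by_cases hw : ∃ u ∈ f.support, Finsupp.linearCombination ℕ a' u = w
  · obtain ⟨u, hu, rfl⟩ := hw
    have hcoeff := congrArg (coeff (Finsupp.linearCombination ℕ a u)) hf
    rw [coeff_monomialMap, coeff_zero] at hcoeff
    rw [← hcoeff, Finset.filter_congr fun v hv => (h v hv u hu).symm]
  · rw [Finset.filter_false_of_mem fun u hu h' => hw ⟨u, hu, h'⟩, Finset.sum_empty]

lemma monomialMap_eq_zero_iff {a : ι → κ →₀ ℕ} {a' : ι → κ' →₀ ℕ} {f : MvPolynomial ι R}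
    (h : ∀ u ∈ f.support, ∀ v ∈ f.support,
      Finsupp.linearCombination ℕ a u = Finsupp.linearCombination ℕ a v ↔
      Finsupp.linearCombination ℕ a' u = Finsupp.linearCombination ℕ a' v) :
    monomialMap R a f = 0 ↔ monomialMap R a' f = 0 :=
  ⟨monomialMap_eq_zero_of_linearCombination_eq_imp h,
    monomialMap_eq_zero_of_linearCombination_eq_imp fun u hu v hv => (h u hu v hv).symm⟩

lemma linearCombination_apply_eq_sum (a : ι → κ →₀ ℕ) (u : ι →₀ ℕ) (i : κ) :
    Finsupp.linearCombination ℕ a u i = u.sum fun l m => m * a l i := by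
  simp [Finsupp.linearCombination_apply]

lemma monomialMap_eq_zero_iff_of_eq_mul {a a' : ι → κ →₀ ℕ} {c : κ → ℕ} (hc : ∀ i, c i ≠ 0)
    (ha : ∀ l i, a l i = c i * a' l i) (f : MvPolynomial ι R) :
    monomialMap R a f = 0 ↔ monomialMap R a' f = 0 := by
  have hlin : ∀ u i, Finsupp.linearCombination ℕ a u i =
      c i * Finsupp.linearCombination ℕ a' u i := fun u i => by
    simp only [linearCombination_apply_eq_sum, ha, Finsupp.mul_sum, mul_left_comm]
  refine monomialMap_eq_zero_iff fun u _ v _ => ?_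
  simp only [Finsupp.ext_iff, hlin, mul_right_inj' (hc _)]

section Homogeneous

variable {a : ι → κ →₀ ℕ} {D : ℕ}

lemma degree_linearCombination (hdeg : ∀ l, (a l).degree = D) (u : ι →₀ ℕ) :
    (Finsupp.linearCombination ℕ a u).degree = u.degree * D := by
  rw [Finsupp.linearCombination_apply, Finsupp.sum, map_sum, Finsupp.degree_apply, Finset.sum_mul]
  exact Finset.sum_congr rfl fun l _ => by rw [map_nsmul, hdeg, smul_eq_mul]

lemma homogeneousComponent_monomial_eq_ite (N : ℕ) (u : ι →₀ ℕ) (r : R) :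
    homogeneousComponent N (monomial u r) = if u.degree = N then monomial u r else 0 := by
  rw [homogeneousComponent_of_mem (isHomogeneous_monomial r rfl)]
  exact if_congr eq_comm rfl rfl

lemma homogeneousComponent_monomialMap (hD : D ≠ 0) (hdeg : ∀ l, (a l).degree = D) (N : ℕ)
    (f : MvPolynomial ι R) :
    homogeneousComponent (N * D) (monomialMap R a f) =
      monomialMap R a (homogeneousComponent N f) := by
  induction f using MvPolynomial.induction_on' with
  | monomial u r =>
    rw [monomialMap_monomial, homogeneousComponent_monomial_eq_ite,
      homogeneousComponent_monomial_eq_ite, degree_linearCombination hdeg,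
      apply_ite (monomialMap R a), monomialMap_monomial, map_zero]
    simp only [Nat.mul_left_inj hD]
  | add f g hf hg => simp only [map_add, hf, hg]

lemma isHomogeneous_of_homogeneousComponent_mem {I : Ideal (MvPolynomial ι R)}
    (h : ∀ f ∈ I, ∀ N, homogeneousComponent N f ∈ I) :
    I.IsHomogeneous (homogeneousSubmodule ι R) := fun N f hf => by
  have := h f hf N
  rwa [← decomposition.decompose'_apply] at this

lemma isHomogeneous_ker_monomialMap (hD : D ≠ 0) (hdeg : ∀ l, (a l).degree = D) :
    (RingHom.ker (monomialMap R a)).IsHomogeneous (homogeneousSubmodule ι R) :=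
  isHomogeneous_of_homogeneousComponent_mem fun f hf N => by
    rw [RingHom.mem_ker, ← homogeneousComponent_monomialMap hD hdeg, RingHom.mem_ker.1 hf, map_zero]

end Homogeneous

end MonomialMap

section Points

lemma coeff_aeval_C_mul_X {ι R : Type*} [CommSemiring R] (v : ι → R) (f : MvPolynomial ι R)
    (N : ℕ) : (aeval (fun l => Polynomial.C (v l) * Polynomial.X) f).coeff N =
      eval v (homogeneousComponent N f) := by
  induction f using MvPolynomial.induction_on' with
  | monomial u r =>
    have hu : aeval (fun l => Polynomial.C (v l) * Polynomial.X) (monomial u r) =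
        Polynomial.C (eval v (monomial u r)) * Polynomial.X ^ u.degree := by
      simp only [aeval_monomial, eval_monomial, Finsupp.prod, mul_pow, Finset.prod_mul_distrib,
        Finset.prod_pow_eq_pow_sum, ← Finsupp.degree_apply, ← Polynomial.C_eq_algebraMap, map_mul,
        map_prod, map_pow, mul_assoc]
    rw [hu, Polynomial.coeff_C_mul_X_pow, homogeneousComponent_monomial_eq_ite, apply_ite (eval v),
      map_zero]
    exact if_congr eq_comm rfl rfl
  | add f g hf hg => simp only [map_add, Polynomial.coeff_add, hf, hg]

lemma eval_smul_of_isHomogeneous {ι R : Type*} [CommSemiring R] {f : MvPolynomial ι R} {N : ℕ}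
    (hf : f.IsHomogeneous N) (c : R) (v : ι → R) : eval (c • v) f = c ^ N * eval v f := by
  rw [eval_eq, eval_eq, Finset.mul_sum]
  refine Finset.sum_congr rfl fun u hu => ?_
  have hdeg : ∑ l ∈ u.support, u l = N := (hf.degree_eq_sum_deg_support hu).symm
  simp only [Pi.smul_apply, smul_eq_mul, mul_pow, Finset.prod_mul_distrib,
    Finset.prod_pow_eq_pow_sum, hdeg, mul_left_comm]

variable {k : Type*} [Field k] {n : ℕ} {P : Projectivization k (Fin (n + 1) → k)}
  {I : Ideal (MvPolynomial (Fin (n + 1)) k)} {f : MvPolynomial (Fin (n + 1)) k} {N : ℕ}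

lemma mem_pointIdeal_iff : f ∈ pointIdeal P ↔ ∀ N, eval P.rep (homogeneousComponent N f) = 0 := by
  simp only [pointIdeal, RingHom.mem_ker, Polynomial.ext_iff, coeff_aeval_C_mul_X,
    Polynomial.coeff_zero]

lemma isHomogeneous_pointIdeal (P : Projectivization k (Fin (n + 1) → k)) :
    (pointIdeal P).IsHomogeneous (homogeneousSubmodule (Fin (n + 1)) k) :=
  isHomogeneous_of_homogeneousComponent_mem fun f hf N => mem_pointIdeal_iff.2 fun M => by
    rw [homogeneousComponent_of_mem (homogeneousComponent_mem N f)]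
    split_ifs
    · exact mem_pointIdeal_iff.1 hf N
    · exact map_zero _

lemma mem_pointIdeal_iff_of_isHomogeneous (hf : f.IsHomogeneous N) :
    f ∈ pointIdeal P ↔ eval P.rep f = 0 := by
  refine ⟨fun h => ?_, fun h => mem_pointIdeal_iff.2 fun M => ?_⟩
  · simpa [homogeneousComponent_of_mem hf] using mem_pointIdeal_iff.1 h N
  · rw [homogeneousComponent_of_mem hf]
    split_ifs
    · exact h
    · exact map_zero _

lemma mem_pointIdeal_mk_iff {v : Fin (n + 1) → k} (hv : v ≠ 0) (hf : f.IsHomogeneous N) :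
    f ∈ pointIdeal (Projectivization.mk k v hv) ↔ eval v f = 0 := by
  obtain ⟨a, ha⟩ := Projectivization.exists_smul_eq_mk_rep k v hv
  rw [mem_pointIdeal_iff_of_isHomogeneous hf, ← ha, Units.smul_def,
    eval_smul_of_isHomogeneous hf]
  simp

lemma X_mem_pointIdeal_iff {J : Fin (n + 1)} : X J ∈ pointIdeal P ↔ P.rep J = 0 := by
  rw [mem_pointIdeal_iff_of_isHomogeneous (isHomogeneous_X k J), eval_X]

lemma mem_zeroLocus_iff_le_pointIdeal
    (hI : I.IsHomogeneous (homogeneousSubmodule (Fin (n + 1)) k)) :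
    P ∈ zeroLocus I ↔ I ≤ pointIdeal P := by
  refine ⟨fun h f hf => mem_pointIdeal_iff.2 fun N => h _ (homogeneousComponent_mem_of_mem hI hf N),
    fun h f hf => ?_⟩
  rw [← sum_homogeneousComponent f, map_sum]
  exact Finset.sum_eq_zero fun N _ => mem_pointIdeal_iff.1 (h hf) N

lemma mk_mem_zeroLocus (hI : I.IsHomogeneous (homogeneousSubmodule (Fin (n + 1)) k))
    {v : Fin (n + 1) → k} (hv : v ≠ 0) (h : ∀ f ∈ I, eval v f = 0) :
    Projectivization.mk k v hv ∈ zeroLocus I := by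
  refine (mem_zeroLocus_iff_le_pointIdeal hI).2 fun f hf => ?_
  rw [mem_iff_homogeneousComponent_mem (isHomogeneous_pointIdeal _)]
  exact fun N => (mem_pointIdeal_mk_iff hv (homogeneousComponent_isHomogeneous N f)).2
    (h _ (homogeneousComponent_mem_of_mem hI hf N))

lemma mk_rep_eq_zero_iff {v : Fin (n + 1) → k} (hv : v ≠ 0) {J : Fin (n + 1)} :
    (Projectivization.mk k v hv).rep J = 0 ↔ v J = 0 := by
  rw [← X_mem_pointIdeal_iff, mem_pointIdeal_mk_iff hv (isHomogeneous_X k J), eval_X]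

lemma coordPoint_rep_eq_zero_iff {i J : Fin (n + 1)} : (coordPoint k i).rep J = 0 ↔ J ≠ i := by
  rw [coordPoint, mk_rep_eq_zero_iff, Pi.single_apply, ite_eq_right_iff]
  simp only [one_ne_zero, imp_false]

lemma coordPoint_injective : Function.Injective (coordPoint k : Fin (n + 1) → _) := fun i J h => by
  by_contra hne
  exact coordPoint_rep_eq_zero_iff.not.2 (not_not.2 rfl) (h ▸ coordPoint_rep_eq_zero_iff.2 hne)

lemma eq_coordPoint {J : Fin (n + 1)} (h : ∀ l, l ≠ J → P.rep l = 0) : P = coordPoint k J := by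
  rw [← P.mk_rep, coordPoint, Projectivization.mk_eq_mk_iff']
  refine ⟨P.rep J, funext fun l => ?_⟩
  by_cases hl : l = J
  · subst hl; simp
  · simp [hl, h l hl]

end Points

section ToricIdeal

variable {k : Type*} [Field k] {n d D : ℕ} {b : Fin (n + 1) → Fin (d + 1) → ℕ}
  {f : MvPolynomial (Fin (n + 1)) k}

lemma mem_toricIdeal_iff_monomialMap :
    f ∈ toricIdeal k b ↔ monomialMap k (fun l => Finsupp.equivFunOnFinite.symm (b l)) f = 0 := by
  have hprod : ∀ u : Fin (d + 1) →₀ ℕ,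
      ∏ i, (X i : MvPolynomial (Fin (d + 1)) k) ^ u i = monomial u 1 := fun u => by
    rw [monomial_eq, C_1, one_mul, Finsupp.prod_fintype _ _ fun i => pow_zero _]
  simp only [monomialMap, ← hprod, Finsupp.equivFunOnFinite_symm_apply_apply]
  exact RingHom.mem_ker

lemma isHomogeneous_toricIdeal (hD : D ≠ 0) (hdeg : ∀ l, ∑ i, b l i = D) :
    (toricIdeal k b).IsHomogeneous (homogeneousSubmodule (Fin (n + 1)) k) := by
  convert isHomogeneous_ker_monomialMap (R := k) hD
    (a := fun l => Finsupp.equivFunOnFinite.symm (b l)) fun l => ?_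
  · ext f
    exact mem_toricIdeal_iff_monomialMap
  · rw [Finsupp.degree_eq_sum]
    exact hdeg l

lemma eval_eq_zero_of_mem_toricIdeal (hf : f ∈ toricIdeal k b) (t : Fin (d + 1) → k) :
    eval (fun l => ∏ i, t i ^ b l i) f = 0 := by
  have h := congrArg (aeval t) (RingHom.mem_ker.1 hf)
  rw [← AlgHom.comp_apply, comp_aeval, map_zero] at h
  simpa [aeval_eq_eval] using h

lemma X_pow_sub_prod_mem_toricIdeal {v : Fin (d + 1) → Fin (n + 1)}
    (hv : ∀ i, b (v i) = Pi.single i D) (l : Fin (n + 1)) :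
    (X l ^ D - ∏ i, X (v i) ^ b l i : MvPolynomial (Fin (n + 1)) k) ∈ toricIdeal k b := by
  have hpow := monomialMap_X_pow (R := k) (a := fun l => Finsupp.equivFunOnFinite.symm (b l))
    (v := v) (fun i => by rw [hv, Finsupp.equivFunOnFinite_symm_single]) l
  rw [mem_toricIdeal_iff_monomialMap, map_sub, map_pow, hpow, map_prod, sub_eq_zero]
  simp only [map_pow, Finsupp.equivFunOnFinite_symm_apply_apply]

end ToricIdeal

section VertexPoints

variable {k : Type*} [Field k] {n d D : ℕ} {b : Fin (n + 1) → Fin (d + 1) → ℕ}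

lemma exists_ne_zero_of_ne_vertex (hinj : Function.Injective b) (hdeg : ∀ l, ∑ i, b l i = D)
    {J : Fin (n + 1)} {j : Fin (d + 1)} (hJ : b J = Pi.single j D) {l : Fin (n + 1)} (hl : l ≠ J) :
    ∃ i, i ≠ j ∧ b l i ≠ 0 := by
  by_contra! h
  refine hl (hinj ?_)
  rw [hJ, ← hdeg l, Finset.sum_eq_single_of_mem j (Finset.mem_univ j) fun i _ hi => h i hi]
  funext i
  by_cases hi : i = j
  · rw [hi, Pi.single_eq_same]
  · rw [h i hi, Pi.single_eq_of_ne hi]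

lemma coordPoint_mem_zeroLocus (hD : D ≠ 0) (hinj : Function.Injective b)
    (hdeg : ∀ l, ∑ i, b l i = D) {J : Fin (n + 1)} {j : Fin (d + 1)} (hJ : b J = Pi.single j D) :
    coordPoint k J ∈ zeroLocus (toricIdeal k b) := by
  have hmono : (Pi.single J 1 : Fin (n + 1) → k) =
      fun l => ∏ i, (Pi.single j 1 : Fin (d + 1) → k) i ^ b l i := by
    funext l
    by_cases hl : l = J
    · rw [hl, Pi.single_eq_same, hJ, Finset.prod_eq_one fun i _ => ?_]
      by_cases hi : i = j <;> simp [hi]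
    · obtain ⟨i, hij, hi⟩ := exists_ne_zero_of_ne_vertex hinj hdeg hJ hl
      rw [Pi.single_eq_of_ne hl, Finset.prod_eq_zero (Finset.mem_univ i)]
      rw [Pi.single_eq_of_ne hij, zero_pow hi]
  exact mk_mem_zeroLocus (isHomogeneous_toricIdeal hD hdeg) _ fun f hf =>
    hmono ▸ eval_eq_zero_of_mem_toricIdeal hf _

variable {v : Fin (d + 1) → Fin (n + 1)} {P : Projectivization k (Fin (n + 1) → k)}

lemma rep_pow_eq_prod (hv : ∀ i, b (v i) = Pi.single i D)
    (hP : P ∈ zeroLocus (toricIdeal k b)) (l : Fin (n + 1)) :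
    P.rep l ^ D = ∏ i, P.rep (v i) ^ b l i := by
  simpa [sub_eq_zero, eval_prod] using hP _ (X_pow_sub_prod_mem_toricIdeal hv l)

lemma exists_rep_vertex_ne_zero (hD : D ≠ 0) (hdeg : ∀ l, ∑ i, b l i = D)
    (hv : ∀ i, b (v i) = Pi.single i D) (hP : P ∈ zeroLocus (toricIdeal k b)) :
    ∃ i, P.rep (v i) ≠ 0 := by
  by_contra! h
  refine P.rep_nonzero (funext fun l => (pow_eq_zero_iff hD).1 ?_)
  obtain ⟨i, -, hi⟩ := Finset.exists_ne_zero_of_sum_ne_zero ((hdeg l).trans_ne hD)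
  rw [rep_pow_eq_prod hv hP l]
  exact Finset.prod_eq_zero (Finset.mem_univ i) (by rw [h i, zero_pow hi])

lemma eq_coordPoint_of_mem_zeroLocus (hD : D ≠ 0) (hinj : Function.Injective b)
    (hdeg : ∀ l, ∑ i, b l i = D) (hv : ∀ i, b (v i) = Pi.single i D)
    (hP : P ∈ zeroLocus (toricIdeal k b)) {j : Fin (d + 1)}
    (h : ∀ i, i ≠ j → P.rep (v i) = 0) : P = coordPoint k (v j) := by
  refine eq_coordPoint fun l hl => (pow_eq_zero_iff hD).1 ?_
  obtain ⟨i, hij, hi⟩ := exists_ne_zero_of_ne_vertex hinj hdeg (hv j) hl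
  rw [rep_pow_eq_prod hv hP l]
  exact Finset.prod_eq_zero (Finset.mem_univ i) (by rw [h i hij, zero_pow hi])

end VertexPoints

section AffineSemigroup

variable {ι κ : Type*} {a : ι → κ →₀ ℕ}

/-- The affine semigroup generated by the vectors `a l`. -/
abbrev exponentSemigroup (a : ι → κ →₀ ℕ) : AddSubmonoid (κ →₀ ℕ) :=
  AddSubmonoid.closure (Set.range a)

/-- The semigroup generated by the vectors `a l` is freely generated by positive multiples of the
basis vectors. -/
def IsFreeOnAxes (a : ι → κ →₀ ℕ) : Prop :=
  ∃ c : κ → ℕ, ∀ i, 0 < c i ∧ (∀ l, c i ∣ a l i) ∧ ∃ l, a l = Finsupp.single i (c i)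

instance : AddCancelCommMonoid (exponentSemigroup a) where
  __ := AddSubmonoid.toAddCommMonoid (exponentSemigroup a)
  add_left_cancel _ _ _ h := Subtype.ext (add_left_cancel (congrArg Subtype.val h))

instance : Subsingleton (AddUnits (exponentSemigroup a)) :=
  (AddUnits.map_injective (f := (exponentSemigroup a).subtype)
    Subtype.val_injective).subsingleton

lemma exists_eq_of_addIrreducible {s : exponentSemigroup a} (hs : AddIrreducible s) :
    ∃ l, a l = s :=
  addIrreducible_subset_of_addSubmonoidClosure_eq_top
    (AddSubmonoid.closure_closure_coe_preimage (s := Set.range a)) hs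

variable [Finite ι]

lemma mem_closure_addIrreducible (s : exponentSemigroup a) :
    s ∈ AddSubmonoid.closure {p : exponentSemigroup a | AddIrreducible p} :=
  (AddSubmonoid.closure_addIrreducible (M := exponentSemigroup a)).ge (AddSubmonoid.mem_top s)

lemma exists_addIrreducible_le {s : exponentSemigroup a} (hs : s ≠ 0) :
    ∃ p : exponentSemigroup a, AddIrreducible p ∧ p.1 ≤ s.1 := by
  have hclosure := mem_closure_addIrreducible s
  induction hclosure using AddSubmonoid.closure_induction with
  | mem p hp => exact ⟨p, hp, le_rfl⟩
  | zero => exact absurd rfl hs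
  | add x y _ _ hx hy =>
    by_cases hx0 : x = 0
    · obtain ⟨p, hp, hpy⟩ := hy fun hy0 => hs (by rw [hx0, hy0, add_zero])
      exact ⟨p, hp, hpy.trans le_add_self⟩
    · obtain ⟨p, hp, hpx⟩ := hx hx0
      exact ⟨p, hp, hpx.trans le_self_add⟩

lemma exists_addIrreducible_eq_single {D : ℕ} (hD : D ≠ 0) {i : κ}
    (hi : Finsupp.single i D ∈ exponentSemigroup a) :
    ∃ c, 0 < c ∧ ∃ p : exponentSemigroup a, AddIrreducible p ∧ p.1 = Finsupp.single i c := by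
  obtain ⟨p, hp, hle⟩ := exists_addIrreducible_le (s := ⟨_, hi⟩)
    fun h => hD (Finsupp.single_eq_zero.1 (congrArg Subtype.val h))
  have hpi : p.1 = Finsupp.single i (p.1 i) :=
    Finsupp.support_subset_singleton.1 ((Finsupp.support_mono hle).trans
      Finsupp.support_single_subset)
  refine ⟨p.1 i, Nat.pos_of_ne_zero fun h0 => hp.not_isAddUnit ?_, p, hp, hpi⟩
  rw [isAddUnit_iff_eq_zero]
  exact Subtype.ext (by rw [hpi, h0, Finsupp.single_zero]; rfl)

theorem isFreeOnAxes_of_card_addIrreducible_le {D : ℕ} (hD : D ≠ 0)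
    (haxes : ∀ i, Finsupp.single i D ∈ exponentSemigroup a)
    (hcard : Nat.card {p : exponentSemigroup a // AddIrreducible p} ≤ Nat.card κ) :
    IsFreeOnAxes a := by
  classical
  choose c hc p hirr hp using fun i => exists_addIrreducible_eq_single hD (haxes i)
  have hfin : Finite {p : exponentSemigroup a // AddIrreducible p} :=
    finite_addIrreducible.to_subtype
  have hinj : Function.Injective fun i => (⟨p i, hirr i⟩ : {p // AddIrreducible p}) := by
    intro i j hij
    have hsingle : (p i).1 = (p j).1 := congrArg (fun q => q.1.1) hij
    rw [hp, hp, Finsupp.single_eq_single_iff] at hsingle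
    exact hsingle.elim And.left fun h => absurd h.1 (hc i).ne'
  have hdvd : ∀ i, ∀ s : exponentSemigroup a, c i ∣ s.1 i := by
    intro i s
    have hclosure := mem_closure_addIrreducible s
    induction hclosure using AddSubmonoid.closure_induction with
    | mem q hq =>
      obtain ⟨j, hj⟩ := (hinj.bijective_of_nat_card_le hcard).2 ⟨q, hq⟩
      have hj : p j = q := congrArg Subtype.val hj
      rw [← hj, hp, Finsupp.single_apply]
      split_ifs with hij
      · rw [hij]
      · exact dvd_zero _
    | zero => exact dvd_zero _
    | add x y _ _ hx hy => exact dvd_add hx hy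
  refine ⟨c, fun i => ⟨hc i, fun l => hdvd i ⟨a l, AddSubmonoid.subset_closure ⟨l, rfl⟩⟩, ?_⟩⟩
  obtain ⟨l, hl⟩ := exists_eq_of_addIrreducible (hirr i)
  exact ⟨l, hl.trans (hp i)⟩

end AffineSemigroup

section SemigroupRing

variable {R ι κ : Type*}

/-- The semigroup ring of the semigroup generated by the vectors `a l`, realized as the subalgebra
of the polynomial ring spanned by the monomials `t^s`, `s ∈ exponentSemigroup a`. -/
def semigroupRing (R : Type*) [CommSemiring R] (a : ι → κ →₀ ℕ) :
    Subalgebra R (MvPolynomial κ R) :=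
  (monomialMap R a).range

/-- The presentation `x_l ↦ t^{a_l}` of the semigroup ring. -/
def toSemigroupRing (R : Type*) [CommSemiring R] (a : ι → κ →₀ ℕ) :
    MvPolynomial ι R →ₐ[R] semigroupRing R a :=
  (monomialMap R a).rangeRestrict

lemma coe_toSemigroupRing [CommSemiring R] (a : ι → κ →₀ ℕ) (f : MvPolynomial ι R) :
    (toSemigroupRing R a f : MvPolynomial κ R) = monomialMap R a f :=
  rfl

lemma toSemigroupRing_surjective [CommSemiring R] (a : ι → κ →₀ ℕ) :
    Function.Surjective (toSemigroupRing R a) :=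
  (monomialMap R a).rangeRestrict_surjective

lemma toSemigroupRing_eq_zero_iff [CommSemiring R] {a : ι → κ →₀ ℕ} {f : MvPolynomial ι R} :
    toSemigroupRing R a f = 0 ↔ monomialMap R a f = 0 :=
  Subtype.ext_iff

lemma toSemigroupRing_X_pow [CommSemiring R] [Fintype κ] {a : ι → κ →₀ ℕ} {v : κ → ι} {D : ℕ}
    (hv : ∀ i, a (v i) = Finsupp.single i D) (l : ι) :
    toSemigroupRing R a (X l) ^ D = ∏ i, toSemigroupRing R a (X (v i)) ^ a l i := by
  refine Subtype.ext ?_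
  rw [SubmonoidClass.coe_finsetProd]
  exact monomialMap_X_pow hv l

lemma mem_exponentSemigroup_of_coeff_ne_zero [CommSemiring R] {a : ι → κ →₀ ℕ}
    (f : semigroupRing R a) {w : κ →₀ ℕ} (hw : coeff w f.1 ≠ 0) : w ∈ exponentSemigroup a := by
  classical
  obtain ⟨f, rfl⟩ := toSemigroupRing_surjective a f
  rw [coe_toSemigroupRing, coeff_monomialMap] at hw
  obtain ⟨u, hu, -⟩ := Finset.exists_ne_zero_of_sum_ne_zero hw
  rw [← (Finset.mem_filter.1 hu).2, Finsupp.linearCombination_apply]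
  exact sum_mem fun l _ => nsmul_mem (AddSubmonoid.subset_closure (Set.mem_range_self l)) _

/-- The ideal of the origin in the semigroup ring: it is spanned by the monomials `t^s`, `s ≠ 0`. -/
def originIdeal (R : Type*) [CommRing R] (a : ι → κ →₀ ℕ) : Ideal (semigroupRing R a) :=
  RingHom.ker (constantCoeff.comp (semigroupRing R a).val.toRingHom)

instance [CommRing R] [IsDomain R] (a : ι → κ →₀ ℕ) : (originIdeal R a).IsPrime :=
  RingHom.ker_isPrime _

lemma mem_originIdeal_iff [CommRing R] {a : ι → κ →₀ ℕ} {f : semigroupRing R a} :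
    f ∈ originIdeal R a ↔ constantCoeff f.1 = 0 :=
  Iff.rfl

lemma toSemigroupRing_X_mem_originIdeal [CommRing R] {a : ι → κ →₀ ℕ} {l : ι} (hl : a l ≠ 0) :
    toSemigroupRing R a (X l) ∈ originIdeal R a := by
  classical
  rw [mem_originIdeal_iff, coe_toSemigroupRing, monomialMap_X, constantCoeff_monomial, if_neg hl]

lemma originIdeal_le [CommRing R] {a : ι → κ →₀ ℕ} {q : Ideal (semigroupRing R a)}
    (h : ∀ l, a l ≠ 0 → toSemigroupRing R a (X l) ∈ q) : originIdeal R a ≤ q := by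
  classical
  have hconst : (Ideal.Quotient.mk q).comp (toSemigroupRing R a).toRingHom =
      (algebraMap R (semigroupRing R a ⧸ q)).comp
        (constantCoeff.comp (monomialMap R a).toRingHom) := by
    refine MvPolynomial.ringHom_ext (fun r => by simp [← algebraMap_eq]) fun l => ?_
    by_cases hl : a l = 0
    · have hone : toSemigroupRing R a (X l) = 1 :=
        Subtype.ext (by rw [coe_toSemigroupRing, monomialMap_X, hl]; rfl)
      simp [hone, monomialMap_X, hl]
    · simp [monomialMap_X, constantCoeff_monomial, hl, Ideal.Quotient.eq_zero_iff_mem, h l hl]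
  intro f hf
  obtain ⟨f, rfl⟩ := toSemigroupRing_surjective a f
  rw [← Ideal.Quotient.eq_zero_iff_mem]
  exact (RingHom.congr_fun hconst f).trans
    ((congrArg (algebraMap R (semigroupRing R a ⧸ q)) (mem_originIdeal_iff.1 hf)).trans
      (map_zero _))

variable [CommRing R] [IsNoetherianRing R] {a : ι → κ →₀ ℕ}

instance [Finite ι] : IsNoetherianRing (semigroupRing R a) :=
  isNoetherianRing_of_surjective _ _ (toSemigroupRing R a).toRingHom (toSemigroupRing_surjective a)

lemma ringKrullDim_localization_originIdeal_le [IsDomain R] [Finite ι] [Finite κ] {v : κ → ι}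
    {D : ℕ} (hD : D ≠ 0) (hv : ∀ i, a (v i) = Finsupp.single i D) :
    ringKrullDim (Localization.AtPrime (originIdeal R a)) ≤ Nat.card κ := by
  have := Fintype.ofFinite κ
  let z : κ → semigroupRing R a := fun i => toSemigroupRing R a (X (v i))
  have hmin : originIdeal R a ∈ (Ideal.span (Set.range z)).minimalPrimes := by
    refine ⟨⟨inferInstance, Ideal.span_le.2 (Set.range_subset_iff.2 fun i =>
      toSemigroupRing_X_mem_originIdeal (by simp [hv, hD]))⟩, fun q hq _ =>
        originIdeal_le fun l hl => hq.1.mem_of_pow_mem D ?_⟩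
    obtain ⟨i, hi⟩ := Finsupp.ne_iff.1 hl
    rw [toSemigroupRing_X_pow hv]
    exact Ideal.mem_of_dvd _ (Finset.dvd_prod_of_mem _ (Finset.mem_univ i))
      (Ideal.pow_mem_of_mem _ (hq.2 (Ideal.subset_span ⟨i, rfl⟩)) _ (Nat.pos_of_ne_zero hi))
  have hheight := Ideal.height_le_card_of_mem_minimalPrimes_span (Set.finite_range z) hmin
  have hcard : (Set.range z).ncard ≤ Nat.card κ := by
    rw [← Set.image_univ, ← Set.ncard_univ]
    exact Set.ncard_image_le
  rw [IsLocalization.AtPrime.ringKrullDim_eq_height (originIdeal R a)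
    (Localization.AtPrime (originIdeal R a))]
  exact_mod_cast hheight.trans (Nat.cast_le.2 hcard)

end SemigroupRing

section EmbeddingDimension

lemma finrank_le_spanFinrank {R V M : Type*} [CommRing R] [Nontrivial R] [CommRing V]
    [AddCommGroup M] [Module R M] [Module Rᵐᵒᵖ M] {m : Ideal V} (hm : m.FG)
    (Ψ : V →+* TrivSqZeroExt R M) (hfst : ∀ x ∈ m, (Ψ x).fst = 0)
    (hspan : Submodule.span R ((fun x => (Ψ x).snd) '' m) = ⊤) :
    Module.finrank R M ≤ m.spanFinrank := by
  classical
  let G := m.generators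
  have hGfin : G.Finite := Submodule.FG.finite_generators hm
  have hG : ∀ x ∈ m, (Ψ x).snd ∈ Submodule.span R ((fun x => (Ψ x).snd) '' G) := by
    intro x hx
    rw [← m.span_generators] at hx
    induction hx using Submodule.span_induction with
    | mem x hx => exact Submodule.subset_span ⟨x, hx, rfl⟩
    | zero => simp
    | add x y _ _ hx hy => simpa using add_mem hx hy
    | smul r x hx ih =>
      rw [smul_eq_mul, map_mul, TrivSqZeroExt.snd_mul, hfst x (m.span_generators ▸ hx)]
      simpa using Submodule.smul_mem _ _ ih
  have htop : Submodule.span R ((fun x => (Ψ x).snd) '' G) = ⊤ :=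
    top_le_iff.1 (hspan ▸ Submodule.span_le.2 (Set.image_subset_iff.2 hG))
  have := (hGfin.image fun x => (Ψ x).snd).fintype
  rw [← finrank_top R M, ← htop, ← Submodule.FG.generators_ncard hm]
  refine (finrank_span_le_card _).trans ?_
  rw [← Set.ncard_eq_toFinset_card']
  exact Set.ncard_image_le hGfin

lemma finrank_le_spanFinrank_maximalIdeal {k A M : Type*} [Field k] [CommRing A]
    [IsNoetherianRing A] [AddCommGroup M] [Module k M] [Module kᵐᵒᵖ M] [IsCentralScalar k M]
    {p : Ideal A} [p.IsPrime] (Φ : A →+* TrivSqZeroExt k M) (hfst : ∀ x, (Φ x).fst = 0 ↔ x ∈ p)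
    (hspan : Submodule.span k ((fun x => (Φ x).snd) '' p) = ⊤) :
    Module.finrank k M ≤ (IsLocalRing.maximalIdeal (Localization.AtPrime p)).spanFinrank := by
  have hunit : ∀ x : p.primeCompl, IsUnit (Φ x) := fun x =>
    TrivSqZeroExt.isUnit_iff_isUnit_fst.2 (isUnit_iff_ne_zero.2 ((hfst x).not.2 x.2))
  let Ψ : Localization.AtPrime p →+* TrivSqZeroExt k M := IsLocalization.lift hunit
  have hΨ : ∀ x, Ψ (algebraMap A _ x) = Φ x := IsLocalization.lift_eq hunit
  rw [← Localization.AtPrime.map_eq_maximalIdeal]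
  refine finrank_le_spanFinrank (IsNoetherian.noetherian _) Ψ (fun x hx => ?_) ?_
  · suffices hle : p.map (algebraMap A (Localization.AtPrime p)) ≤
        RingHom.ker ((TrivSqZeroExt.fstHom k k M).toRingHom.comp Ψ) from hle hx
    exact Ideal.map_le_iff_le_comap.2 fun x hx =>
      (congrArg TrivSqZeroExt.fst (hΨ x)).trans ((hfst x).2 hx)
  · rw [← top_le_iff, ← hspan, Submodule.span_le]
    rintro _ ⟨x, hx, rfl⟩
    exact Submodule.subset_span ⟨algebraMap A _ x, Ideal.mem_map_of_mem _ hx, by simp only [hΨ]⟩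

end EmbeddingDimension

section OriginRegular

variable {R k ι κ : Type*} [CommRing R] [Field k] {a : ι → κ →₀ ℕ}

lemma coe_ne_zero_of_addIrreducible {s : exponentSemigroup a} (hs : AddIrreducible s) :
    s.1 ≠ 0 :=
  fun h => hs.not_isAddUnit (isAddUnit_iff_eq_zero.2 (Subtype.ext h))

lemma coeff_mul_of_addIrreducible (f g : semigroupRing R a) {s : exponentSemigroup a}
    (hs : AddIrreducible s) :
    coeff s.1 (f * g).1 = coeff 0 f.1 * coeff s.1 g.1 + coeff s.1 f.1 * coeff 0 g.1 := by
  classical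
  have hpair : ∀ x ∈ Finset.HasAntidiagonal.antidiagonal s.1,
      x ∉ ({(0, s.1), (s.1, 0)} : Finset _) → coeff x.1 f.1 * coeff x.2 g.1 = 0 := by
    rintro ⟨x, y⟩ hxy hne
    rw [Finset.HasAntidiagonal.mem_antidiagonal] at hxy
    by_contra hmul
    have hx := mem_exponentSemigroup_of_coeff_ne_zero f (left_ne_zero_of_mul hmul)
    have hy := mem_exponentSemigroup_of_coeff_ne_zero g (right_ne_zero_of_mul hmul)
    rcases hs.isAddUnit_or_isAddUnit (a := ⟨x, hx⟩) (b := ⟨y, hy⟩)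
      (Subtype.ext hxy.symm) with h | h
    · have h : x = 0 := congrArg Subtype.val (isAddUnit_iff_eq_zero.1 h)
      simp [← hxy, h] at hne
    · have h : y = 0 := congrArg Subtype.val (isAddUnit_iff_eq_zero.1 h)
      simp [← hxy, h] at hne
  rw [MulMemClass.coe_mul, coeff_mul, ← Finset.sum_subset ?_ hpair,
    Finset.sum_pair (by simp [coe_ne_zero_of_addIrreducible hs])]
  simp [Finset.insert_subset_iff]

/-- The expansion of an element of the semigroup ring to first order at the origin: the cotangent
space at the origin has the irreducible elements of the semigroup as a basis. -/
def firstOrderExpansion (R : Type*) [CommRing R] (a : ι → κ →₀ ℕ) :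
    semigroupRing R a →+* TrivSqZeroExt R ({s : exponentSemigroup a // AddIrreducible s} → R) where
  toFun f := .inl (coeff 0 f.1) + .inr fun s => coeff s.1.1 f.1
  map_one' := by
    classical
    refine TrivSqZeroExt.ext (by simp) (funext fun s => ?_)
    simp [coeff_one, (coe_ne_zero_of_addIrreducible s.2).symm]
  map_mul' f g := by
    refine TrivSqZeroExt.ext ?_ (funext fun s => ?_)
    · simp [← constantCoeff_eq]
    · simpa [mul_comm] using coeff_mul_of_addIrreducible f g s.2
  map_zero' := by
    refine TrivSqZeroExt.ext (by simp) (funext fun s => by simp)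
  map_add' f g := by
    refine TrivSqZeroExt.ext (by simp) (funext fun s => by simp)

lemma fst_firstOrderExpansion (f : semigroupRing R a) :
    (firstOrderExpansion R a f).fst = constantCoeff f.1 := by
  simp [firstOrderExpansion, constantCoeff_eq]

lemma snd_firstOrderExpansion (f : semigroupRing R a)
    (s : {s : exponentSemigroup a // AddIrreducible s}) :
    (firstOrderExpansion R a f).snd s = coeff s.1.1 f.1 := by
  simp [firstOrderExpansion]

open scoped Classical in
lemma snd_firstOrderExpansion_toSemigroupRing_X {l : ι}
    {s : {s : exponentSemigroup a // AddIrreducible s}} (hl : a l = s.1.1) :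
    (firstOrderExpansion R a (toSemigroupRing R a (X l))).snd = Pi.single s 1 := by
  funext t
  rw [snd_firstOrderExpansion, coe_toSemigroupRing, monomialMap_X, coeff_monomial, hl,
    Pi.single_apply]
  simp only [Subtype.val_inj, eq_comm]

theorem card_addIrreducible_le_spanFinrank_maximalIdeal [Finite ι] :
    Nat.card {s : exponentSemigroup a // AddIrreducible s} ≤
      (IsLocalRing.maximalIdeal (Localization.AtPrime (originIdeal k a))).spanFinrank := by
  classical
  have hfin : Finite {s : exponentSemigroup a // AddIrreducible s} :=
    finite_addIrreducible.to_subtype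
  have := Fintype.ofFinite {s : exponentSemigroup a // AddIrreducible s}
  rw [Nat.card_eq_fintype_card, ← Module.finrank_fintype_fun_eq_card k]
  refine finrank_le_spanFinrank_maximalIdeal (firstOrderExpansion k a)
    (fun f => by rw [fst_firstOrderExpansion, mem_originIdeal_iff]) ?_
  rw [← top_le_iff, ← (Pi.basisFun k _).span_eq, Submodule.span_le]
  rintro _ ⟨s, rfl⟩
  obtain ⟨l, hl⟩ := exists_eq_of_addIrreducible s.2
  rw [Pi.basisFun_apply, ← snd_firstOrderExpansion_toSemigroupRing_X hl]
  exact Submodule.subset_span ⟨_, toSemigroupRing_X_mem_originIdeal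
    (hl ▸ coe_ne_zero_of_addIrreducible s.2), rfl⟩

theorem isFreeOnAxes_of_isRegularLocalRing [Finite ι] [Finite κ] {v : κ → ι} {D : ℕ} (hD : D ≠ 0)
    (hv : ∀ i, a (v i) = Finsupp.single i D)
    (hreg : IsRegularLocalRing (Localization.AtPrime (originIdeal k a))) : IsFreeOnAxes a := by
  refine isFreeOnAxes_of_card_addIrreducible_le hD
    (fun i => hv i ▸ AddSubmonoid.subset_closure (Set.mem_range_self (v i))) ?_
  have hdim := ringKrullDim_localization_originIdeal_le (R := k) hD hv
  rw [← hreg.spanFinrank_maximalIdeal, Nat.cast_le] at hdim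
  exact card_addIrreducible_le_spanFinrank_maximalIdeal.trans hdim

end OriginRegular

section FreeSemigroup

variable {R k ι κ : Type*} [CommRing R] [Field k] [Finite κ] {a : ι → κ →₀ ℕ}

lemma IsFreeOnAxes.exists_ringEquiv (h : IsFreeOnAxes a) :
    Nonempty (MvPolynomial κ R ≃+* semigroupRing R a) := by
  obtain ⟨c, hc⟩ := h
  have hc0 : ∀ i, c i ≠ 0 := fun i => (hc i).1.ne'
  let a' : ι → κ →₀ ℕ := fun l => Finsupp.equivFunOnFinite.symm fun i => a l i / c i
  have ha : ∀ l i, a l i = c i * a' l i := fun l i => (Nat.mul_div_cancel' ((hc i).2.1 l)).symm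
  have hsurj : Function.Surjective (monomialMap R a') := monomialMap_surjective fun i => by
    obtain ⟨l, hl⟩ := (hc i).2.2
    refine ⟨l, Finsupp.ext fun x => mul_left_cancel₀ (hc0 x) ?_⟩
    rw [← ha, hl]
    by_cases hx : i = x
    · rw [hx, Finsupp.single_eq_same, Finsupp.single_eq_same, mul_one]
    · rw [Finsupp.single_eq_of_ne' hx, Finsupp.single_eq_of_ne' hx, mul_zero]
  have hker : RingHom.ker (monomialMap R a').toRingHom =
      RingHom.ker (toSemigroupRing R a).toRingHom := by
    ext f
    exact (monomialMap_eq_zero_iff_of_eq_mul hc0 ha f).symm.trans toSemigroupRing_eq_zero_iff.symm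
  exact ⟨((RingHom.quotientKerEquivOfSurjective hsurj).symm.trans (Ideal.quotEquivOfEq hker)).trans
    (RingHom.quotientKerEquivOfSurjective (toSemigroupRing_surjective a))⟩

theorem IsFreeOnAxes.isRegularRing (h : IsFreeOnAxes a) : IsRegularRing (semigroupRing k a) := by
  obtain ⟨e⟩ := h.exists_ringEquiv (R := k)
  exact IsRegularRing.of_ringEquiv e

end FreeSemigroup

section VertexChart

variable {k : Type*} [Field k] {n d D : ℕ} {b : Fin (n + 1) → Fin (d + 1) → ℕ} {j : Fin (d + 1)}

/-- The exponent vectors of the parametrization of the toric variety in the chart of the vertex `j`,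
where `t_j` is set equal to `1`. -/
def chartExp (b : Fin (n + 1) → Fin (d + 1) → ℕ) (j : Fin (d + 1)) (l : Fin (n + 1)) :
    {i : Fin (d + 1) // i ≠ j} →₀ ℕ :=
  Finsupp.equivFunOnFinite.symm fun i => b l i

@[simp]
lemma chartExp_apply (l : Fin (n + 1)) (i : {i : Fin (d + 1) // i ≠ j}) :
    chartExp b j l i = b l i :=
  rfl

lemma eq_single_add_single_iff_chartExp (hdeg : ∀ l, ∑ i, b l i = D) {l : Fin (n + 1)} {c : ℕ}
    {i : Fin (d + 1)} (hi : i ≠ j) :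
    b l = Pi.single i c + Pi.single j (D - c) ↔ chartExp b j l = Finsupp.single ⟨i, hi⟩ c := by
  have hsum := Fintype.sum_eq_add_sum_subtype_ne (b l) j
  rw [hdeg] at hsum
  constructor <;> intro h
  · ext x
    simp [h, Finsupp.single_apply, Pi.single_apply, Subtype.ext_iff, x.2, eq_comm]
  · have hoff : ∀ x : {x // x ≠ j}, b l x = Finsupp.single ⟨i, hi⟩ c x := fun x => by
      rw [← h, chartExp_apply]
    funext x
    by_cases hx : x = j
    · simp only [hoff, Finsupp.univ_sum_single_apply] at hsum
      simp [hx, hi.symm, hsum]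
    · rw [hoff ⟨x, hx⟩]
      simp [Finsupp.single_apply, Pi.single_apply, hx, eq_comm]

lemma eq_of_degree_eq_of_forall_ne {κ : Type*} {s t : κ →₀ ℕ} {j : κ} (hdeg : s.degree = t.degree)
    (h : ∀ i, i ≠ j → s i = t i) : s = t := by
  have herase : s.erase j = t.erase j := Finsupp.ext fun i => by
    by_cases hi : i = j
    · rw [hi, Finsupp.erase_same, Finsupp.erase_same]
    · rw [Finsupp.erase_ne hi, Finsupp.erase_ne hi, h i hi]
  rw [← Finsupp.single_add_erase j s, ← Finsupp.single_add_erase j t, herase] at hdeg ⊢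
  rw [map_add, map_add, add_left_inj, Finsupp.degree_single, Finsupp.degree_single] at hdeg
  rw [hdeg]

lemma monomialMap_chartExp_eq_zero_iff (hdeg : ∀ l, ∑ i, b l i = D) {N : ℕ}
    {f : MvPolynomial (Fin (n + 1)) k} (hf : f.IsHomogeneous N) :
    monomialMap k (chartExp b j) f = 0 ↔ f ∈ toricIdeal k b := by
  rw [mem_toricIdeal_iff_monomialMap]
  refine monomialMap_eq_zero_iff fun u hu v hv => ?_
  set β : Fin (n + 1) → Fin (d + 1) →₀ ℕ := fun l => Finsupp.equivFunOnFinite.symm (b l)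
  have hchart : ∀ (w : Fin (n + 1) →₀ ℕ) (i : {i // i ≠ j}),
      Finsupp.linearCombination ℕ (chartExp b j) w i = Finsupp.linearCombination ℕ β w i :=
    fun w i => by simp only [linearCombination_apply_eq_sum]; rfl
  have hdegβ : ∀ w ∈ f.support, (Finsupp.linearCombination ℕ β w).degree = N * D := fun w hw => by
    rw [degree_linearCombination (D := D) fun l => (Finsupp.degree_eq_sum _).trans (hdeg l),
      Finsupp.degree_apply, ← hf.degree_eq_sum_deg_support hw]
  refine ⟨fun h => ?_, fun h => Finsupp.ext fun i => by rw [hchart, hchart, h]⟩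
  refine eq_of_degree_eq_of_forall_ne (j := j) ((hdegβ u hu).trans (hdegβ v hv).symm) fun i hi => ?_
  rw [← hchart u ⟨i, hi⟩, ← hchart v ⟨i, hi⟩, h]

variable {J : Fin (n + 1)}

lemma chartExp_eq_zero (hJ : b J = Pi.single j D) : chartExp b j J = 0 :=
  Finsupp.ext fun i => by rw [chartExp_apply, hJ, Pi.single_eq_of_ne i.2]; rfl

lemma chartExp_eq_zero_iff (hinj : Function.Injective b) (hdeg : ∀ l, ∑ i, b l i = D)
    (hJ : b J = Pi.single j D) {l : Fin (n + 1)} : chartExp b j l = 0 ↔ l = J := by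
  refine ⟨fun h => of_not_not fun hl => ?_, fun h => h ▸ chartExp_eq_zero hJ⟩
  obtain ⟨i, hij, hi⟩ := exists_ne_zero_of_ne_vertex hinj hdeg hJ hl
  exact hi (DFunLike.congr_fun h ⟨i, hij⟩)

lemma constantCoeff_monomialMap_chartExp (hinj : Function.Injective b)
    (hdeg : ∀ l, ∑ i, b l i = D) (hJ : b J = Pi.single j D)
    (f : MvPolynomial (Fin (n + 1)) k) :
    constantCoeff (monomialMap k (chartExp b j) f) = eval (Pi.single J 1) f := by
  classical
  suffices h : constantCoeff.comp (monomialMap k (chartExp b j)).toRingHom = eval (Pi.single J 1)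
    from RingHom.congr_fun h f
  refine MvPolynomial.ringHom_ext (fun r => by simp [← algebraMap_eq]) fun l => ?_
  simp [monomialMap_X, constantCoeff_monomial, chartExp_eq_zero_iff hinj hdeg hJ, Pi.single_apply]

lemma isDehomogenization_toSemigroupRing (hdeg : ∀ l, ∑ i, b l i = D)
    (hJ : b J = Pi.single j D) :
    IsDehomogenization (homogeneousSubmodule (Fin (n + 1)) k) (toricIdeal k b) (X J)
      (toSemigroupRing k (chartExp b j)).toRingHom where
  surjective := toSemigroupRing_surjective _
  mem_one := isHomogeneous_X k J
  map_eq_one := Subtype.ext <| (monomialMap_X _ _).trans (by rw [chartExp_eq_zero hJ]; rfl)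
  map_eq_zero_iff hf := toSemigroupRing_eq_zero_iff.trans (monomialMap_chartExp_eq_zero_iff hdeg hf)

theorem isRegularLocalRing_of_isFreeOnAxes_chartExp (hD : D ≠ 0) (hdeg : ∀ l, ∑ i, b l i = D)
    (hJ : b J = Pi.single j D) (hfree : IsFreeOnAxes (chartExp b j))
    {P : Projectivization k (Fin (n + 1) → k)} (hP : P ∈ zeroLocus (toricIdeal k b))
    (hPJ : P.rep J ≠ 0) : IsRegularLocalRing (VarietyLocalRing (toricIdeal k b) P) := by
  have hdehom := isDehomogenization_toSemigroupRing (k := k) hdeg hJ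
  have hI := isHomogeneous_toricIdeal (k := k) hD hdeg
  have hp := isHomogeneous_pointIdeal P
  have hIp := (mem_zeroLocus_iff_le_pointIdeal hI).1 hP
  have hs := X_mem_pointIdeal_iff.not.2 hPJ
  have := hdehom.isPrime_map hp hIp hs
  have := hfree.isRegularRing (k := k)
  let e := hdehom.localRingEquiv hI fun N f hf => hdehom.map_mem_map_iff hp hIp hs hf
  exact .of_ringEquiv e.symm

theorem isRegularLocalRing_coordPoint_iff {v : Fin (d + 1) → Fin (n + 1)} (hD : D ≠ 0)
    (hinj : Function.Injective b) (hdeg : ∀ l, ∑ i, b l i = D)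
    (hv : ∀ i, b (v i) = Pi.single i D) :
    IsRegularLocalRing (VarietyLocalRing (toricIdeal k b) (coordPoint k (v j))) ↔
      IsFreeOnAxes (chartExp b j) := by
  refine ⟨fun hreg => ?_, fun hfree => ?_⟩
  · have hq : ∀ N, ∀ f ∈ homogeneousSubmodule (Fin (n + 1)) k N,
        ((toSemigroupRing k (chartExp b j)).toRingHom f ∈ originIdeal k (chartExp b j) ↔
          f ∈ pointIdeal (coordPoint k (v j))) := fun N f hf => by
      rw [coordPoint, mem_pointIdeal_mk_iff _ hf,
        ← constantCoeff_monomialMap_chartExp hinj hdeg (hv j)]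
      exact mem_originIdeal_iff
    let e : VarietyLocalRing (toricIdeal k b) (coordPoint k (v j)) ≃+*
        Localization.AtPrime (originIdeal k (chartExp b j)) :=
      (isDehomogenization_toSemigroupRing hdeg (hv j)).localRingEquiv
        (isHomogeneous_toricIdeal hD hdeg) hq
    refine isFreeOnAxes_of_isRegularLocalRing (v := fun i => v i) hD (fun i => ?_)
      (.of_ringEquiv e)
    rw [← eq_single_add_single_iff_chartExp hdeg i.2, hv, Nat.sub_self, Pi.single_zero, add_zero]
  · exact isRegularLocalRing_of_isFreeOnAxes_chartExp hD hdeg (hv j) hfree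
      (coordPoint_mem_zeroLocus hD hinj hdeg (hv j))
      (coordPoint_rep_eq_zero_iff.not.2 (not_not.2 rfl))

end VertexChart

section SingularPoints

variable {k : Type*} [Field k] {n d D : ℕ} {b : Fin (n + 1) → Fin (d + 1) → ℕ} {j : Fin (d + 1)}
  {v : Fin (d + 1) → Fin (n + 1)} {P : Projectivization k (Fin (n + 1) → k)}

lemma coordPoint_mem_singularPoints_iff (hD : D ≠ 0) (hinj : Function.Injective b)
    (hdeg : ∀ l, ∑ i, b l i = D) (hv : ∀ i, b (v i) = Pi.single i D) :
    coordPoint k (v j) ∈ singularPoints k b ↔ ¬ IsFreeOnAxes (chartExp b j) := by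
  rw [← isRegularLocalRing_coordPoint_iff (k := k) hD hinj hdeg hv]
  exact and_iff_right (coordPoint_mem_zeroLocus hD hinj hdeg (hv j))

lemma coordPoint_mem_singularPoints_of_rep_ne_zero (hD : D ≠ 0) (hinj : Function.Injective b)
    (hdeg : ∀ l, ∑ i, b l i = D) (hv : ∀ i, b (v i) = Pi.single i D)
    (hP : P ∈ singularPoints k b) (hPj : P.rep (v j) ≠ 0) :
    coordPoint k (v j) ∈ singularPoints k b :=
  (coordPoint_mem_singularPoints_iff hD hinj hdeg hv).2 fun hfree =>
    hP.2 (isRegularLocalRing_of_isFreeOnAxes_chartExp hD hdeg (hv j) hfree hP.1 hPj)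

theorem exists_eq_coordPoint_of_singularPoints_eq_singleton (hD : D ≠ 0)
    (hinj : Function.Injective b) (hdeg : ∀ l, ∑ i, b l i = D)
    (hv : ∀ i, b (v i) = Pi.single i D) (hP : singularPoints k b = {P}) :
    ∃ i, P = coordPoint k (v i) := by
  have hPsing : P ∈ singularPoints k b := hP ▸ Set.mem_singleton P
  obtain ⟨i, hi⟩ := exists_rep_vertex_ne_zero hD hdeg hv hPsing.1
  have hmem := coordPoint_mem_singularPoints_of_rep_ne_zero hD hinj hdeg hv hPsing hi
  rw [hP] at hmem
  exact ⟨i, hmem.symm⟩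

theorem singularPoints_eq_singleton_coordPoint_iff (hD : D ≠ 0) (hinj : Function.Injective b)
    (hdeg : ∀ l, ∑ i, b l i = D) (hv : ∀ i, b (v i) = Pi.single i D) :
    singularPoints k b = {coordPoint k (v j)} ↔ ∀ i, IsFreeOnAxes (chartExp b i) ↔ i ≠ j := by
  have hvinj : Function.Injective v := fun i i' h => by
    by_contra hne
    have hi := congrFun ((hv i).symm.trans ((congrArg b h).trans (hv i'))) i
    rw [Pi.single_eq_same, Pi.single_eq_of_ne hne] at hi
    exact hD hi
  have hcoord := fun i => coordPoint_mem_singularPoints_iff (k := k) (j := i) hD hinj hdeg hv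
  refine ⟨fun h i => ?_, fun h => Set.eq_singleton_iff_unique_mem.2
    ⟨(hcoord j).2 ((h j).not.2 (not_not.2 rfl)), fun P hP => ?_⟩⟩
  · rw [← not_iff_not, ← hcoord i, h, Set.mem_singleton_iff, coordPoint_injective.eq_iff,
      hvinj.eq_iff, not_not]
  · refine eq_coordPoint_of_mem_zeroLocus hD hinj hdeg hv hP.1 fun i hi => of_not_not fun hPi => ?_
    exact (hcoord i).1 (coordPoint_mem_singularPoints_of_rep_ne_zero hD hinj hdeg hv hP hPi)
      ((h i).2 hi)

end SingularPoints

section OneSingularShape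

variable {n d D : ℕ} {b : Fin (n + 1) → Fin (d + 1) → ℕ} {i j : Fin (d + 1)}
  {v : Fin (d + 1) → Fin (n + 1)}

/-- The greatest common divisor of the `i`-th coordinates of the vectors of `B`. -/
def coordGcd (b : Fin (n + 1) → Fin (d + 1) → ℕ) (i : Fin (d + 1)) : ℕ :=
  Finset.univ.gcd fun l => b l i

lemma coordGcd_dvd (l : Fin (n + 1)) (i : Fin (d + 1)) : coordGcd b i ∣ b l i :=
  Finset.gcd_dvd (Finset.mem_univ l)

lemma dvd_coordGcd {c : ℕ} (hc : ∀ l, c ∣ b l i) : c ∣ coordGcd b i :=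
  Finset.dvd_gcd fun l _ => hc l

lemma coordGcd_eq_of_dvd {c : ℕ} (hc : ∀ l, c ∣ b l i) {l : Fin (n + 1)} (hl : b l i = c) :
    coordGcd b i = c :=
  Nat.dvd_antisymm (hl ▸ coordGcd_dvd l i) (dvd_coordGcd hc)

lemma coordGcd_dvd_of_vertex (hv : ∀ i, b (v i) = Pi.single i D) (i : Fin (d + 1)) :
    coordGcd b i ∣ D := by
  simpa [hv] using coordGcd_dvd (b := b) (v i) i

theorem isFreeOnAxes_chartExp_iff (hD : D ≠ 0) (hdeg : ∀ l, ∑ i, b l i = D)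
    (hv : ∀ i, b (v i) = Pi.single i D) :
    IsFreeOnAxes (chartExp b j) ↔ ∀ i, i ≠ j →
      Pi.single i (coordGcd b i) + Pi.single j (D - coordGcd b i) ∈ Set.range b := by
  constructor
  · rintro ⟨c, hc⟩ i hi
    obtain ⟨-, hdvd, l, hl⟩ := hc ⟨i, hi⟩
    have hgcd : coordGcd b i = c ⟨i, hi⟩ :=
      coordGcd_eq_of_dvd hdvd (l := l) (by simpa using DFunLike.congr_fun hl ⟨i, hi⟩)
    exact ⟨l, hgcd ▸ (eq_single_add_single_iff_chartExp hdeg hi).2 hl⟩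
  · refine fun h => ⟨fun i => coordGcd b i, fun i =>
      ⟨Nat.pos_of_dvd_of_pos (coordGcd_dvd_of_vertex hv i) (Nat.pos_of_ne_zero hD),
        fun l => coordGcd_dvd l i.1, ?_⟩⟩
    obtain ⟨l, hl⟩ := h i i.2
    exact ⟨l, (eq_single_add_single_iff_chartExp hdeg i.2).1 hl⟩

lemma coordGcd_dvd_coordGcd (hD : D ≠ 0) (hdeg : ∀ l, ∑ i, b l i = D)
    (hv : ∀ i, b (v i) = Pi.single i D) (hfree : IsFreeOnAxes (chartExp b j)) (i : Fin (d + 1)) :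
    coordGcd b j ∣ coordGcd b i := by
  by_cases hi : i = j
  · rw [hi]
  · obtain ⟨l, hl⟩ := (isFreeOnAxes_chartExp_iff hD hdeg hv).1 hfree i hi
    have hdvd := coordGcd_dvd (b := b) l j
    rw [hl, Pi.add_apply, Pi.single_eq_of_ne' hi, Pi.single_eq_same, zero_add] at hdvd
    have hsub := Nat.dvd_sub (coordGcd_dvd_of_vertex hv j) hdvd
    rwa [Nat.sub_sub_self (Nat.le_of_dvd (Nat.pos_of_ne_zero hD) (coordGcd_dvd_of_vertex hv i))]
      at hsub

lemma coordGcd_eq_one (hD : D ≠ 0) (hdeg : ∀ l, ∑ i, b l i = D)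
    (hv : ∀ i, b (v i) = Pi.single i D) (hgcd : ∀ g : ℕ, (∀ l i, g ∣ b l i) → g = 1)
    (hfree : IsFreeOnAxes (chartExp b j)) : coordGcd b j = 1 :=
  hgcd _ fun l i => (coordGcd_dvd_coordGcd hD hdeg hv hfree i).trans (coordGcd_dvd l i)

theorem oneSingularShape_of_forall_isFreeOnAxes_iff (hD : D ≠ 0) (hdeg : ∀ l, ∑ i, b l i = D)
    (hv : ∀ i, b (v i) = Pi.single i D) (hgcd : ∀ g : ℕ, (∀ l i, g ∣ b l i) → g = 1)
    (hfree : ∀ i, IsFreeOnAxes (chartExp b i) ↔ i ≠ 0) : OneSingularShape D b := by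
  have hone : ∀ i, i ≠ 0 → coordGcd b i = 1 := fun i hi =>
    coordGcd_eq_one hD hdeg hv hgcd ((hfree i).2 hi)
  have hedge : ∀ i j, j ≠ 0 → i ≠ j →
      Pi.single i (coordGcd b i) + Pi.single j (D - coordGcd b i) ∈ Set.range b := fun i j hj =>
    (isFreeOnAxes_chartExp_iff hD hdeg hv).1 ((hfree j).2 hj) i
  have hdvdD := coordGcd_dvd_of_vertex hv 0
  refine ⟨coordGcd b 0, Nat.pos_of_dvd_of_pos hdvdD (Nat.pos_of_ne_zero hD), hdvdD,
    fun l => coordGcd_dvd l 0, fun i j hi hj => ?_, fun j hj => hedge 0 j hj hj.symm, fun _ => ?_⟩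
  · by_cases hij : i = j
    · refine ⟨v i, ?_⟩
      rw [hv, hij, ← Pi.single_add, Nat.sub_add_cancel (Nat.one_le_iff_ne_zero.2 hD)]
    · simpa only [hone j hj, add_comm] using hedge j i hi (Ne.symm hij)
  · have hsing := (isFreeOnAxes_chartExp_iff hD hdeg hv).not.1 ((hfree 0).not.2 (not_not.2 rfl))
    push Not at hsing
    obtain ⟨i, hi, hnot⟩ := hsing
    exact ⟨i, hi, by rwa [hone i hi, add_comm (Pi.single _ _)] at hnot⟩

namespace OneSingularShape

lemma coordGcd_eq_one_of_ne (h : OneSingularShape D b) (hi : i ≠ 0) (hj : j ≠ 0) (hij : i ≠ j) :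
    coordGcd b i = 1 := by
  obtain ⟨-, -, -, -, hedge, -, -⟩ := h
  obtain ⟨l, hl⟩ := hedge j i hj hi
  exact coordGcd_eq_of_dvd (fun _ => one_dvd _) (l := l) (by simp [hl, hij])

lemma isFreeOnAxes_chartExp (hD : D ≠ 0) (hdeg : ∀ l, ∑ i, b l i = D)
    (hv : ∀ i, b (v i) = Pi.single i D) (h : OneSingularShape D b) (hj : j ≠ 0) :
    IsFreeOnAxes (chartExp b j) := by
  refine (isFreeOnAxes_chartExp_iff hD hdeg hv).2 fun i hij => ?_
  have ⟨e, _, _, hdvd, hedge, hedge₀, _⟩ := h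
  by_cases hi : i = 0
  · obtain ⟨l, hl⟩ := hedge₀ j hj
    have hgcd : coordGcd b 0 = e := coordGcd_eq_of_dvd hdvd (l := l) (by simp [hl, hj.symm])
    rw [hi, hgcd]
    exact ⟨l, hl⟩
  · rw [h.coordGcd_eq_one_of_ne hi hj hij, add_comm (Pi.single _ _)]
    exact hedge j i hj hi

lemma not_isFreeOnAxes_chartExp_zero (hD : D ≠ 0) (hdeg : ∀ l, ∑ i, b l i = D)
    (hv : ∀ i, b (v i) = Pi.single i D) (hgcd : ∀ g : ℕ, (∀ l i, g ∣ b l i) → g = 1)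
    (h : OneSingularShape D b) : ¬ IsFreeOnAxes (chartExp b 0) := fun hfree => by
  have ⟨e, _, _, hdvd, _, _, hmissing⟩ := h
  have he : e = 1 :=
    Nat.dvd_one.1 (coordGcd_eq_one hD hdeg hv hgcd hfree ▸ dvd_coordGcd hdvd)
  obtain ⟨j, hj, hnot⟩ := hmissing he
  have hedge := (isFreeOnAxes_chartExp_iff hD hdeg hv).1 hfree j hj
  rw [coordGcd_eq_one hD hdeg hv hgcd (h.isFreeOnAxes_chartExp hD hdeg hv hj),
    add_comm (Pi.single _ _)] at hedge
  exact hnot hedge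

lemma eq_one_of_forall_dvd (h : OneSingularShape D b) (hd : 2 ≤ d) {g : ℕ}
    (hg : ∀ l i, g ∣ b l i) : g = 1 := by
  obtain ⟨i, hi, -⟩ := Fin.exists_ne_and_ne_of_two_lt (0 : Fin (d + 1)) 0 (by lia)
  obtain ⟨j, hj, hji⟩ := Fin.exists_ne_and_ne_of_two_lt 0 i (by lia)
  exact Nat.dvd_one.1 (h.coordGcd_eq_one_of_ne hi hj hji.symm ▸ dvd_coordGcd fun l => hg l i)

end OneSingularShape

theorem forall_isFreeOnAxes_iff_oneSingularShape (hD : D ≠ 0) (hdeg : ∀ l, ∑ i, b l i = D)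
    (hv : ∀ i, b (v i) = Pi.single i D) (hgcd : ∀ g : ℕ, (∀ l i, g ∣ b l i) → g = 1) :
    (∀ i, IsFreeOnAxes (chartExp b i) ↔ i ≠ 0) ↔ OneSingularShape D b := by
  refine ⟨oneSingularShape_of_forall_isFreeOnAxes_iff hD hdeg hv hgcd, fun h i =>
    ⟨?_, h.isFreeOnAxes_chartExp hD hdeg hv⟩⟩
  rintro hfree rfl
  exact h.not_isFreeOnAxes_chartExp_zero hD hdeg hv hgcd hfree

end OneSingularShape

end

end ToricSing

theorem mainTheorem9_general {k : Type*} [Field k] {n d : ℕ} (hdn : d + 1 ≤ n + 1)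
    (D : ℕ) (hD : 0 < D) (b : Fin (n + 1) → Fin (d + 1) → ℕ) (hinj : Function.Injective b)
    (hvert : ∀ i : Fin (d + 1), b (Fin.castLE hdn i) = Pi.single i D)
    (hdeg : ∀ l, ∑ i, b l i = D) :
    (∀ P, ToricSing.singularPoints k b = {P} →
      ∃ i : Fin (d + 1), P = ToricSing.coordPoint k (Fin.castLE hdn i)) ∧
    ((∀ g : ℕ, (∀ l i, g ∣ b l i) → g = 1) →
      (ToricSing.singularPoints k b = {ToricSing.coordPoint k 0} ↔
        ToricSing.OneSingularShape D b)) ∧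
    (2 ≤ d → ToricSing.OneSingularShape D b →
      ToricSing.singularPoints k b = {ToricSing.coordPoint k 0}) := by
  have hshape (hgcd : ∀ g : ℕ, (∀ l i, g ∣ b l i) → g = 1) :
      ToricSing.singularPoints k b = {ToricSing.coordPoint k 0} ↔ ToricSing.OneSingularShape D b :=
    (ToricSing.singularPoints_eq_singleton_coordPoint_iff (j := 0) hD.ne' hinj hdeg hvert).trans
      (ToricSing.forall_isFreeOnAxes_iff_oneSingularShape hD.ne' hdeg hvert hgcd)
  refine ⟨fun P hP => ?_, hshape, fun hd h => ?_⟩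
  · exact ToricSing.exists_eq_coordPoint_of_singularPoints_eq_singleton hD.ne' hinj hdeg hvert hP
  · exact (hshape fun _ hg => h.eq_one_of_forall_dvd hd hg).2 h

theorem mainTheorem9 {k : Type*} [Field k] [IsAlgClosed k] {n d : ℕ} (hdn : d + 1 ≤ n + 1)
    (D : ℕ) (hD : 0 < D) (b : Fin (n + 1) → Fin (d + 1) → ℕ) (hinj : Function.Injective b)
    (hvert : ∀ i : Fin (d + 1), b (Fin.castLE hdn i) = Pi.single i D)
    (hdeg : ∀ l, ∑ i, b l i = D) :
    (∀ P, ToricSing.singularPoints k b = {P} →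
      ∃ i : Fin (d + 1), P = ToricSing.coordPoint k (Fin.castLE hdn i)) ∧
    ((∀ g : ℕ, (∀ l i, g ∣ b l i) → g = 1) →
      (ToricSing.singularPoints k b = {ToricSing.coordPoint k 0} ↔
        ToricSing.OneSingularShape D b)) ∧
    (2 ≤ d → ToricSing.OneSingularShape D b →
      ToricSing.singularPoints k b = {ToricSing.coordPoint k 0}) :=
  mainTheorem9_general hdn D hD b hinj hvert hdeg
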